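/- Let $G$ be a group (with no topology and of any cardinality). A trace on $G$ is a function $\varphi:G\to\mathbb{C}$ that is positive definite (for all $g_1,\dots,g_n\in G$ the matrix $(\varphi(g_i^{-1}g_j))_{i,j}$ is positive semidefinite), conjugation invariant, and satisfies $\varphi(e)=1$. The set $\mathrm{Tr}(G)$ of traces is convex and carries the topology of pointwise convergence; its extreme points are called characters, and they form the subspace $\mathrm{Ch}(G)$. The group $G$ has property (ET) if the trivial character $1_G$ (the constant function $1$) is an isolated point of $\mathrm{Ch}(G)$. Proposition. (a) If the groups $G_1,\dots,G_m$ have property (ET), then so does their free product $G_1*\cdots*G_m$. (b) If a group $G$ has property (ET), then so does every quotient $G/N$ by a normal subgroup $N$. (c) Let $G_1$ and $G_2$ be groups with property (ET), let $H$ be any group, and let $f_1:H\to G_1$ and $f_2:H\to G_2$ be any homomorphisms (not assumed injective). Then the amalgamated product $G_1*_H G_2$, that is, the quotient of $G_1*G_2$ by the normal subgroup generated by the elements $f_1(h)f_2(h)^{-1}$, $h\in H$, has property (ET). -/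

import Mathlib

open scoped ComplexOrder

universe u v w

namespace GroupTrace

/-- `φ : G → ℂ` is positive definite: for all `g₁, …, gₙ ∈ G` the matrix `(φ (gᵢ⁻¹ gⱼ))ᵢⱼ`
is positive semidefinite. -/
def IsPosDef {G : Type*} [Group G] (φ : G → ℂ) : Prop :=
  ∀ (n : ℕ) (g : Fin n → G),
    (Matrix.of fun i j : Fin n => φ ((g i)⁻¹ * g j)).PosSemidef

/-- A trace on a group: a positive definite, conjugation invariant function with `φ 1 = 1`. -/
structure IsTrace {G : Type*} [Group G] (φ : G → ℂ) : Prop where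
  posDef : IsPosDef φ
  conj_invariant : ∀ g h : G, φ (h * g * h⁻¹) = φ g
  map_one : φ 1 = 1

/-- The convex set of traces on `G`, inside `G → ℂ` with the topology of pointwise convergence. -/
def traces (G : Type*) [Group G] : Set (G → ℂ) := {φ | IsTrace φ}

/-- The characters of `G`: the extreme points of the set of traces. -/
def characters (G : Type*) [Group G] : Set (G → ℂ) := Set.extremePoints ℝ (traces G)

/-- Property (ET): the trivial character (the constant function `1`) is an isolated point of the
space of characters, i.e. some open set for pointwise convergence meets the characters in exactly that point. -/
def PropertyET (G : Type*) [Group G] : Prop :=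
  ∃ U : Set (G → ℂ), IsOpen U ∧ U ∩ characters G = {fun _ => 1}

/-- The amalgamated product `G₁ *_H G₂` along arbitrary homomorphisms `f₁ : H → G₁`,
`f₂ : H → G₂`: the quotient of the free product by the normal subgroup generated by the
elements `f₁(h) f₂(h)⁻¹`. -/
abbrev AmalgamatedProduct {H G₁ G₂ : Type*} [Group H] [Group G₁] [Group G₂]
    (f₁ : H →* G₁) (f₂ : H →* G₂) : Type _ :=
  Monoid.Coprod G₁ G₂ ⧸ Subgroup.normalClosure
    (Set.range fun h : H =>
      (Monoid.Coprod.inl (f₁ h) * (Monoid.Coprod.inr (f₂ h))⁻¹ : Monoid.Coprod G₁ G₂))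

end GroupTrace

/-!
A subgroup `K` of `G` is called *rigid* here (`GroupTrace.IsRigid`) if every trace `φ` on `G` that
is close to `1` on a suitable finite set dominates, on `K`, a constant `c` close to `1`: the
function `φ|_K - c` is positive definite, with `1 - c` bounded linearly in terms of the values of
`1 - Re φ` on the finite set. Three facts about rigidity give the theorem.

* If `G'` has property (ET) and `f : G' →* G`, then the range of `f` is rigid
  (`PropertyET.isRigid_range`). By `PropertyET.exists_weight`, the traces on `G'` admitting a good
  constant `c` form a compact convex set; it contains every character, with `c = 1` for the trivial
  character and `c = 0` for the others, which are uniformly far from `1`. By the Krein–Milman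
  theorem it contains every trace. Pulling a trace on `G` back along `f` gives rigidity of the
  range.
* If `K` and `L` are rigid, so is `K ⊔ L` (`IsRigid.sup`). In the GNS representation of a trace `φ`
  with cyclic vector `ξ`, the largest constant dominated by `φ` on `K` is `‖P ξ‖²`, where `P` is the
  projection to the `K`-fixed vectors. These projections commute with the right translations, and
  `T ↦ ⟪ξ, T ξ⟫` is tracial on the commutant of the right translations, so the inequality
  `τ(P) + τ(Q) ≤ τ(P ∧ Q) + τ(1)` is available (`norm_sq_starProjection_add_le`). It is in this
  inequality that conjugation invariance of `φ` is indispensable.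
* If `G` is rigid in itself, it has property (ET) (`IsRigid.propertyET`): a character near `1`
  splits off a positive multiple of the trivial character, hence equals it by extremality.

So `G` has property (ET) as soon as it is generated by finitely many homomorphic images of groups
with property (ET), and free products, quotients and amalgamated products are all of this kind.
-/

namespace GroupTrace

open scoped InnerProductSpace
open Filter Topology

/-! ### Isometries determined by inner products on a total family -/

section Hilbert

/-- A total family can be moved isometrically onto any family with the same Gram matrix. -/
theorem exists_linearIsometry_of_inner_eq {𝕜 E F ι : Type*} [RCLike 𝕜]
    [NormedAddCommGroup E] [InnerProductSpace 𝕜 E]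
    [NormedAddCommGroup F] [InnerProductSpace 𝕜 F] [CompleteSpace F] (v : ι → E) (w : ι → F)
    (h : ∀ i j, ⟪v i, v j⟫_𝕜 = ⟪w i, w j⟫_𝕜)
    (hv : (Submodule.span 𝕜 (Set.range v)).topologicalClosure = ⊤) :
    ∃ U : E →ₗᵢ[𝕜] F, ∀ i, U (v i) = w i := by
  classical
  set A := Finsupp.linearCombination 𝕜 v
  set B := Finsupp.linearCombination 𝕜 w
  have hA : DenseRange A := by
    have : Dense (Submodule.span 𝕜 (Set.range v) : Set E) :=
      Submodule.dense_iff_topologicalClosure_eq_top.2 hv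
    rwa [← Finsupp.range_linearCombination, LinearMap.coe_range] at this
  have hinner (x : ι →₀ 𝕜) : ⟪A x, A x⟫_𝕜 = ⟪B x, B x⟫_𝕜 := by
    simp only [A, B, Finsupp.linearCombination_apply, Finsupp.sum_inner, Finsupp.inner_sum,
      inner_smul_left, inner_smul_right, h]
  have hnorm (x : ι →₀ 𝕜) : ‖B x‖ = ‖A x‖ := by
    rw [norm_eq_sqrt_re_inner (𝕜 := 𝕜), norm_eq_sqrt_re_inner (𝕜 := 𝕜), hinner]
  have hC : ∃ C, ∀ x, ‖B x‖ ≤ C * ‖A x‖ := ⟨1, fun x => by simp [hnorm]⟩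
  refine ⟨⟨(B.extendOfNorm A).toLinearMap, fun x => ?_⟩, fun i => ?_⟩
  · refine hA.induction_on (p := fun x => ‖(B.extendOfNorm A) x‖ = ‖x‖) x
      (isClosed_eq (by fun_prop) (by fun_prop)) fun a => ?_
    rw [LinearMap.extendOfNorm_eq hA hC, hnorm]
  · have := LinearMap.extendOfNorm_eq hA hC (Finsupp.single i 1)
    simpa [A, B] using this

theorem clm_eq_of_total {𝕜 E F ι : Type*} [RCLike 𝕜]
    [NormedAddCommGroup E] [NormedSpace 𝕜 E] [NormedAddCommGroup F] [NormedSpace 𝕜 F]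
    {v : ι → E} (hv : (Submodule.span 𝕜 (Set.range v)).topologicalClosure = ⊤)
    (S T : E →L[𝕜] F) (h : ∀ i, S (v i) = T (v i)) : S = T := by
  refine ContinuousLinearMap.ext_on (Submodule.dense_iff_topologicalClosure_eq_top.2 hv) ?_
  rintro _ ⟨i, rfl⟩
  exact h i

theorem exists_unitaryRep_of_inner_smul_eq {K ι H : Type*} [Group K] [MulAction K ι]
    [NormedAddCommGroup H] [InnerProductSpace ℂ H] [CompleteSpace H] (v : ι → H)
    (h : ∀ (k : K) i j, ⟪v (k • i), v (k • j)⟫_ℂ = ⟪v i, v j⟫_ℂ)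
    (hv : (Submodule.span ℂ (Set.range v)).topologicalClosure = ⊤) :
    ∃ π : K →* (H ≃ₗᵢ[ℂ] H), ∀ k i, π k (v i) = v (k • i) := by
  choose U hU using fun k : K =>
    exists_linearIsometry_of_inner_eq (𝕜 := ℂ) v (fun i => v (k • i)) (fun i j => (h k i j).symm) hv
  have hmul (k l : K) (x : H) : U (k * l) x = U k (U l x) := by
    have := clm_eq_of_total hv (U (k * l)).toContinuousLinearMap
      ((U k).toContinuousLinearMap.comp (U l).toContinuousLinearMap)
      (fun i => by simp [hU, mul_smul])
    exact DFunLike.congr_fun this x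
  have hone (x : H) : U 1 x = x := by
    have := clm_eq_of_total hv (U 1).toContinuousLinearMap (ContinuousLinearMap.id ℂ H)
      (fun i => by simp [hU])
    exact DFunLike.congr_fun this x
  let e (k : K) : H ≃ₗᵢ[ℂ] H := LinearIsometryEquiv.ofSurjective (U k)
    (fun x => ⟨U k⁻¹ x, by rw [← hmul, mul_inv_cancel, hone]⟩)
  refine ⟨⟨⟨e, ?_⟩, ?_⟩, fun k i => hU k i⟩
  · ext x; exact hone x
  · intro k l; ext x; exact hmul k l x

end Hilbert

/-! ### A trace inequality for the intersection of two projections -/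

section Projections
variable {H : Type*} [NormedAddCommGroup H] [InnerProductSpace ℂ H]

/-- Tracial functionals do not distinguish polynomials in `S * T` from the same polynomials in
`T * S`; this is the case of the powers of `1 - X`. -/
theorem apply_one_sub_mul_pow_comm {A B : Type*} [Ring A] [AddCommGroup B] (M : Subring A)
    (τ : A →+ B) (hτ : ∀ S ∈ M, ∀ T ∈ M, τ (S * T) = τ (T * S)) {S T : A} (hS : S ∈ M)
    (hT : T ∈ M) (n : ℕ) : τ ((1 - S * T) ^ n) = τ ((1 - T * S) ^ n) := by
  have hcomm (n : ℕ) : (1 - S * T) ^ n * S = S * (1 - T * S) ^ n := by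
    induction n with
    | zero => simp
    | succ n ih =>
      rw [pow_succ, mul_assoc, show (1 - S * T) * S = S * (1 - T * S) by noncomm_ring,
        ← mul_assoc, ih, mul_assoc, ← pow_succ]
  induction n with
  | zero => simp
  | succ n ih =>
    have h1 : (1 - S * T) ^ (n + 1) = (1 - S * T) ^ n - S * ((1 - T * S) ^ n * T) := by
      rw [pow_succ, mul_sub, mul_one, ← mul_assoc, hcomm, mul_assoc]
    have h2 : (1 - T * S) ^ (n + 1) = (1 - T * S) ^ n - ((1 - T * S) ^ n * T) * S := by
      rw [pow_succ, mul_sub, mul_one, ← mul_assoc]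
    have hM : (1 - T * S) ^ n * T ∈ M :=
      M.mul_mem (M.pow_mem (M.sub_mem M.one_mem (M.mul_mem hT hS)) n) hT
    rw [h1, h2, map_sub, map_sub, ih, hτ S hS _ hM]

theorem one_sub_add_pow {R : Type*} [Ring R] {p x : R} (hp : p * p = p) (hpx : p * x = x)
    (hxp : x * p = x) (n : ℕ) : (1 - p + x) ^ (n + 1) = 1 - p + x ^ (n + 1) := by
  have h1 : (1 - p) * x = 0 := by rw [sub_mul, hpx, one_mul, sub_self]
  have h3 : (1 - p) * (1 - p) = 1 - p := by simp [mul_sub, sub_mul, hp]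
  induction n with
  | zero => simp
  | succ n ih =>
    have h2 : x ^ (n + 1) * (1 - p) = 0 := by
      rw [pow_succ, mul_assoc, mul_sub, hxp, mul_one, sub_self, mul_zero]
    rw [pow_succ, ih, add_mul, mul_add, mul_add, h1, h2, h3, pow_succ _ (n + 1)]
    simp

theorem re_inner_starProjection_right (U : Submodule ℂ H) [U.HasOrthogonalProjection] (x : H) :
    (⟪x, U.starProjection x⟫_ℂ).re = ‖U.starProjection x‖ ^ 2 := by
  rw [← RCLike.re_eq_complex_re, inner_re_symm]
  exact U.re_inner_starProjection_eq_normSq x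

/-- The inequality `τ(P) + τ(Q) ≤ τ(P ∧ Q) + τ(1)` for projections in an operator ring on which the
vector functional `τ = ⟪ξ, · ξ⟫` is tracial. With `S = P(1 - Q)` and `T = (1 - Q)P`, the traces
of `(1 - S T)ⁿ = (1 - P) + (P Q P)ⁿ` and of `(1 - T S)ⁿ ≥ Q` agree, so
`τ((P Q P)ⁿ) ≥ τ(P) + τ(Q) - τ(1)`, and the ergodic averages of `(P Q P)ⁿ` converge strongly to
`P ∧ Q`. -/
theorem norm_sq_starProjection_add_le [CompleteSpace H] (M : Subring (H →L[ℂ] H)) (ξ : H)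
    (hM : ∀ S ∈ M, ∀ T ∈ M, (⟪ξ, S (T ξ)⟫_ℂ).re = (⟪ξ, T (S ξ)⟫_ℂ).re) (U W : Submodule ℂ H)
    [U.HasOrthogonalProjection] [W.HasOrthogonalProjection] [(U ⊓ W).HasOrthogonalProjection]
    (hU : U.starProjection ∈ M) (hW : W.starProjection ∈ M) :
    ‖U.starProjection ξ‖ ^ 2 + ‖W.starProjection ξ‖ ^ 2 ≤
      ‖(U ⊓ W).starProjection ξ‖ ^ 2 + ‖ξ‖ ^ 2 := by
  set P := U.starProjection with hP
  set Q := W.starProjection with hQ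
  have hPP : P * P = P := U.isIdempotentElem_starProjection
  have hQQ : Q * Q = Q := W.isIdempotentElem_starProjection
  have hPn : ∀ x, ‖P x‖ ≤ ‖x‖ := U.norm_starProjection_apply_le
  have hQn : ∀ x, ‖Q x‖ ≤ ‖x‖ := W.norm_starProjection_apply_le
  let τ : (H →L[ℂ] H) →+ ℝ := AddMonoidHom.mk' (fun T => (⟪ξ, T ξ⟫_ℂ).re) (by simp)
  have hτ (T) : τ T = (⟪ξ, T ξ⟫_ℂ).re := rfl
  have hξ : (⟪ξ, ξ⟫_ℂ).re = ‖ξ‖ ^ 2 := by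
    rw [← RCLike.re_eq_complex_re, inner_self_eq_norm_sq]
  set f := P * Q * P with hf
  have hpow (n : ℕ) : ‖P ξ‖ ^ 2 + ‖Q ξ‖ ^ 2 - ‖ξ‖ ^ 2 ≤ (⟪ξ, (f ^ n) ξ⟫_ℂ).re := by
    -- `one_sub_add_pow` needs a positive exponent; for `n = 0`, it suffices that
    -- `P` and `Q` are contractions.
    rcases n with _ | n
    · have h1 := pow_le_pow_left₀ (norm_nonneg _) (hPn ξ) 2
      have h2 := pow_le_pow_left₀ (norm_nonneg _) (hQn ξ) 2
      simp only [pow_zero, one_apply_eq_self, hξ]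
      linarith
    have h := apply_one_sub_mul_pow_comm M τ hM (S := P * (1 - Q)) (T := (1 - Q) * P)
      (M.mul_mem hU (M.sub_mem M.one_mem hW)) (M.mul_mem (M.sub_mem M.one_mem hW) hU) (n + 1)
    set y := (1 - Q) * (1 - P) * (1 - Q) with hy
    have hQ1 : (1 - Q) * (1 - Q) = 1 - Q := by simp [mul_sub, sub_mul, hQQ]
    have hP1 : (1 - P) * (1 - P) = 1 - P := by simp [mul_sub, sub_mul, hPP]
    have e1 : 1 - P * (1 - Q) * ((1 - Q) * P) = 1 - P + f := by
      rw [mul_assoc, ← mul_assoc (1 - Q), hQ1, hf]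
      simp only [mul_sub, sub_mul, one_mul, ← mul_assoc, hPP]; abel
    have e2 : 1 - (1 - Q) * P * (P * (1 - Q)) = 1 - (1 - Q) + y := by
      rw [mul_assoc, ← mul_assoc P, hPP, hy, mul_sub (1 - Q) 1 P, mul_one, sub_mul _ _ (1 - Q), hQ1,
        mul_assoc, sub_add_sub_cancel]
    rw [e1, e2, one_sub_add_pow hPP (by rw [hf, ← mul_assoc, ← mul_assoc, hPP])
      (by rw [hf, mul_assoc, hPP]), one_sub_add_pow hQ1 (by rw [hy, ← mul_assoc, ← mul_assoc, hQ1])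
      (by rw [hy, mul_assoc, hQ1]), sub_sub_cancel] at h
    have hypos : 0 ≤ (⟪ξ, (y ^ (n + 1)) ξ⟫_ℂ).re := by
      have hsaP : star P = P := isSelfAdjoint_starProjection U
      have hsaQ : star Q = Q := isSelfAdjoint_starProjection W
      have h0 : 0 ≤ y := by
        have : y = star ((1 - P) * (1 - Q)) * ((1 - P) * (1 - Q)) := by
          rw [star_mul, star_sub, star_sub, hsaP, hsaQ, star_one, mul_assoc,
            ← mul_assoc (1 - P), hP1, hy, mul_assoc]
        rw [this]
        exact star_mul_self_nonneg _
      have h1 : 0 ≤ y ^ (n + 1) := CStarAlgebra.pow_nonneg h0 _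
      exact (ContinuousLinearMap.nonneg_iff_isPositive _ |>.1 h1).re_inner_nonneg_right ξ
    simp only [hτ, add_apply, sub_apply,
      one_apply_eq_self, inner_add_right, inner_sub_right, Complex.add_re,
      Complex.sub_re, re_inner_starProjection_right, hP, hQ, hξ] at h
    linarith
  have hfn : ‖f‖ ≤ 1 := by
    refine f.opNorm_le_bound zero_le_one fun x => ?_
    rw [one_mul]
    exact (hPn _).trans ((hQn _).trans (hPn _))
  have hfix : f.eqLocus (1 : H →L[ℂ] H) = U ⊓ W := by
    ext x
    simp only [LinearMap.mem_eqLocus, Submodule.mem_inf]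
    constructor
    · intro h
      have h : P (Q (P x)) = x := h
      have hx : P x = x := Submodule.starProjection_eq_self_iff.2
        (by rw [← h]; exact U.starProjection_apply_mem _)
      rw [hx] at h
      have hn : ‖Q x‖ = ‖x‖ := le_antisymm (hQn x) (by
        calc ‖x‖ = ‖P (Q x)‖ := by rw [h]
          _ ≤ ‖Q x‖ := hPn _)
      exact ⟨Submodule.starProjection_eq_self_iff.1 hx, (W.mem_iff_norm_starProjection x).2 hn⟩
    · rintro ⟨h1, h2⟩
      change P (Q (P x)) = x
      have h1 : P x = x := Submodule.starProjection_eq_self_iff.2 h1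
      have h2 : Q x = x := Submodule.starProjection_eq_self_iff.2 h2
      rw [h1, h2, h1]
  have hlim : Tendsto (birkhoffAverage ℂ f _root_.id · ξ) atTop
      (𝓝 ((U ⊓ W).starProjection ξ)) := by
    have := f.tendsto_birkhoffAverage_orthogonalProjection hfn ξ
    simp only [← Submodule.starProjection_apply] at this
    convert this using 4
    exact hfix.symm
  have hlim2 := ((Complex.continuous_re.tendsto _).comp
    ((continuous_const.inner continuous_id : Continuous fun x : H => ⟪ξ, x⟫_ℂ).tendsto _)).comp hlim
  have hge : ‖P ξ‖ ^ 2 + ‖Q ξ‖ ^ 2 - ‖ξ‖ ^ 2 ≤ (⟪ξ, (U ⊓ W).starProjection ξ⟫_ℂ).re := by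
    refine ge_of_tendsto hlim2 ?_
    filter_upwards [eventually_gt_atTop 0] with N hN
    have hN' : (0 : ℝ) < N := by exact_mod_cast hN
    have : (⟪ξ, birkhoffAverage ℂ f _root_.id N ξ⟫_ℂ).re =
        (N : ℝ)⁻¹ * ∑ n ∈ Finset.range N, (⟪ξ, (f ^ n) ξ⟫_ℂ).re := by
      rw [birkhoffAverage, birkhoffSum, inner_smul_right, inner_sum, ← Complex.ofReal_natCast,
        ← Complex.ofReal_inv, Complex.re_ofReal_mul, Complex.re_sum]
      simp
    change _ ≤ (⟪ξ, birkhoffAverage ℂ f _root_.id N ξ⟫_ℂ).re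
    rw [this, le_inv_mul_iff₀ hN']
    calc _ = ∑ n ∈ Finset.range N, (‖P ξ‖ ^ 2 + ‖Q ξ‖ ^ 2 - ‖ξ‖ ^ 2) := by
          rw [Finset.sum_const, Finset.card_range, nsmul_eq_mul]
      _ ≤ _ := Finset.sum_le_sum fun n _ => hpow n
  rw [re_inner_starProjection_right] at hge
  linarith

end Projections

/-! ### The Hilbert space of a positive semidefinite kernel -/

section GNS

/-- A positive semidefinite kernel is the Gram matrix of a total family in a Hilbert space, namely
the family of point masses in the completion of the finitely supported functions. -/
theorem exists_hilbert_of_posSemidef {ι : Type u} {k : Matrix ι ι ℂ} (hk : k.PosSemidef) :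
    ∃ (H : Type u) (_ : NormedAddCommGroup H) (_ : InnerProductSpace ℂ H) (_ : CompleteSpace H)
      (v : ι → H), (∀ i j, ⟪v i, v j⟫_ℂ = k i j) ∧
        (Submodule.span ℂ (Set.range v)).topologicalClosure = ⊤ := by
  let c : PreInnerProductSpace.Core ℂ (ι →₀ ℂ) :=
    { inner f g := f.sum fun i x => g.sum fun j y => star x * k i j * y
      conj_inner_symm f g := by
        rw [Finsupp.sum_comm]
        simp only [map_finsuppSum]
        congr! 6 with i x j y
        rw [← hk.isHermitian.apply]
        simp; ring
      re_inner_nonneg f := (Complex.nonneg_iff.1 (hk.2 f)).1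
      add_left f g h := by
        rw [Finsupp.sum_add_index'] <;> simp [← Finsupp.sum_add, add_mul]
      smul_left f g r := by
        rw [Finsupp.sum_smul_index] <;> simp [Finsupp.mul_sum, mul_assoc] }
  let _ : SeminormedAddCommGroup (ι →₀ ℂ) :=
    InnerProductSpace.Core.toSeminormedAddCommGroup (𝕜 := ℂ) (c := c)
  let _ : InnerProductSpace ℂ (ι →₀ ℂ) := InnerProductSpace.ofCore c
  have hinner (f g : ι →₀ ℂ) :
    ⟪f, g⟫_ℂ = f.sum fun i x => g.sum fun j y => star x * k i j * y := rfl
  let v : ι → UniformSpace.Completion (ι →₀ ℂ) := fun i => ((Finsupp.single i 1 : ι →₀ ℂ) :)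
  refine ⟨UniformSpace.Completion (ι →₀ ℂ), inferInstance, inferInstance, inferInstance, v, ?_, ?_⟩
  · intro i j
    simp [v, UniformSpace.Completion.inner_coe, hinner]
  · rw [← Submodule.dense_iff_topologicalClosure_eq_top]
    refine UniformSpace.Completion.denseRange_coe.mono ?_
    rintro _ ⟨f, rfl⟩
    induction f using Finsupp.induction_linear with
    | zero => exact Submodule.zero_mem _
    | add f g hf hg =>
      rw [UniformSpace.Completion.coe_add]
      exact Submodule.add_mem _ hf hg
    | single i a =>
      have : Finsupp.single i a = a • (Finsupp.single i 1 : ι →₀ ℂ) := by simp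
      rw [this, UniformSpace.Completion.coe_smul]
      exact Submodule.smul_mem _ _ (Submodule.subset_span ⟨i, rfl⟩)

/-- The kernel `⟪v i, v j⟫ - c` is positive semidefinite exactly when combinations of the `v i` with
coefficient sum `s` have squared norm at least `c |s|²`. -/
theorem posSemidef_inner_sub_const_iff {ι H : Type*} [NormedAddCommGroup H]
    [InnerProductSpace ℂ H] (v : ι → H) (c : ℝ) :
    (Matrix.of fun i j => ⟪v i, v j⟫_ℂ - c).PosSemidef ↔
      ∀ a : ι →₀ ℂ, c * ‖a.sum fun _ x => x‖ ^ 2 ≤ ‖a.sum fun i x => x • v i‖ ^ 2 := by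
  have hherm : (Matrix.of fun i j => ⟪v i, v j⟫_ℂ - c).IsHermitian := by
    ext i j
    simp
  rw [Matrix.PosSemidef, and_iff_right hherm]
  refine forall_congr' fun a => ?_
  have h1 : ((‖a.sum fun i x => x • v i‖ ^ 2 : ℝ) : ℂ) =
      a.sum fun i x => a.sum fun j y => star x * ⟪v i, v j⟫_ℂ * y := by
    rw [Complex.ofReal_pow, ← RCLike.ofReal_eq_complex_ofReal, ← inner_self_eq_norm_sq_to_K]
    rw [Finsupp.sum_inner]
    simp only [Finsupp.inner_sum, inner_smul_left, inner_smul_right, ]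
    refine Finsupp.sum_congr fun i _ => Finsupp.sum_congr fun j _ => ?_
    simp; ring
  have h2 : ((‖a.sum fun _ x => x‖ ^ 2 : ℝ) : ℂ) =
      a.sum fun i x => a.sum fun j y => star x * y := by
    rw [Complex.ofReal_pow, ← Complex.conj_mul', map_finsuppSum, Finsupp.sum_mul]
    simp [Finsupp.mul_sum]
  have h3 : (a.sum fun i x => a.sum fun j y =>
      star x * (Matrix.of fun i j => ⟪v i, v j⟫_ℂ - c) i j * y) =
      ((‖a.sum fun i x => x • v i‖ ^ 2 - c * ‖a.sum fun _ x => x‖ ^ 2 : ℝ) : ℂ) := by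
    rw [Complex.ofReal_sub, Complex.ofReal_mul, h1, h2, Finsupp.mul_sum, ← Finsupp.sum_sub]
    refine Finsupp.sum_congr fun i _ => ?_
    rw [Finsupp.mul_sum, ← Finsupp.sum_sub]
    refine Finsupp.sum_congr fun j _ => ?_
    simp; ring
  rw [h3, Complex.zero_le_real, sub_nonneg]

/-- Positive definiteness in terms of a single, possibly infinite, matrix indexed by the group. -/
theorem isPosDef_iff_posSemidef {G : Type*} [Group G] {φ : G → ℂ} :
    IsPosDef φ ↔ (Matrix.of fun g h : G => φ (g⁻¹ * h)).PosSemidef := by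
  refine ⟨fun h => ⟨?_, fun x => ?_⟩, fun h n g => h.submatrix g⟩
  · ext i j
    simpa using congrFun (congrFun (h 2 ![i, j]).1 0) 1
  · let e := x.support.equivFin.symm
    have := (h _ fun i => (e i : G)).dotProduct_mulVec_nonneg (fun i => x (e i))
    convert! this using 1
    simp only [Finsupp.sum, dotProduct, Matrix.mulVec, Finset.mul_sum]
    rw [← Finset.sum_coe_sort, ← e.sum_comp]
    refine Finset.sum_congr rfl fun i _ => ?_
    rw [← Finset.sum_coe_sort, ← e.sum_comp]
    simp [mul_assoc]

end GNS

/-! ### Vectors fixed by a subgroup -/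

section Fixed

variable {G H : Type*} [Group G] [NormedAddCommGroup H] [InnerProductSpace ℂ H]

/-- The vectors fixed by the subgroup `K` under the unitary representation `π`. -/
def fixedVectors (π : G →* (H ≃ₗᵢ[ℂ] H)) (K : Subgroup G) : Submodule ℂ H where
  carrier := {x | ∀ k ∈ K, π k x = x}
  add_mem' hx hy k hk := by rw [map_add, hx k hk, hy k hk]
  zero_mem' k _ := map_zero _
  smul_mem' c x hx k hk := by rw [map_smul, hx k hk]

theorem isClosed_fixedVectors (π : G →* (H ≃ₗᵢ[ℂ] H)) (K : Subgroup G) :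
    IsClosed (fixedVectors π K : Set H) := by
  have : (fixedVectors π K : Set H) = ⋂ k ∈ K, {x | π k x = x} := by
    ext x; simp [fixedVectors]
  rw [this]
  exact isClosed_biInter fun k _ => isClosed_eq (π k).continuous continuous_id

instance [CompleteSpace H] (π : G →* (H ≃ₗᵢ[ℂ] H)) (K : Subgroup G) :
    CompleteSpace (fixedVectors π K) :=
  (isClosed_fixedVectors π K).completeSpace_coe

theorem fixedVectors_sup (π : G →* (H ≃ₗᵢ[ℂ] H)) (K L : Subgroup G) :
    fixedVectors π (K ⊔ L) = fixedVectors π K ⊓ fixedVectors π L := by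
  refine le_antisymm (le_inf (fun x hx k hk => hx k (le_sup_left (a := K) hk))
    fun x hx k hk => hx k (le_sup_right (a := K) hk)) ?_
  rintro x ⟨hK, hL⟩
  let S : Subgroup G :=
    { carrier := {g | π g x = x}
      mul_mem' := fun {a b} ha hb => by
        change π (a * b) x = x
        rw [map_mul]
        exact (congrArg (π a) hb).trans ha
      one_mem' := by simp
      inv_mem' := fun {a} ha => by
        change π a⁻¹ x = x
        rw [map_inv, LinearIsometryEquiv.inv_def, LinearIsometryEquiv.symm_apply_eq]
        exact ha.symm }
  exact fun k hk => (sup_le hK hL : K ⊔ L ≤ S) hk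

theorem inner_apply_inv {π : G →* (H ≃ₗᵢ[ℂ] H)} (g : G) (x y : H) :
    ⟪π g⁻¹ x, y⟫_ℂ = ⟪x, π g y⟫_ℂ := by
  rw [← LinearIsometryEquiv.inner_map_map (π g) (π g⁻¹ x) y, map_inv]
  exact congrArg (⟪·, π g y⟫_ℂ) ((π g).apply_symm_apply x)

theorem starProjection_fixedVectors_apply [CompleteSpace H] (π : G →* (H ≃ₗᵢ[ℂ] H))
    (K : Subgroup G) {k : G} (hk : k ∈ K) (x : H) :
    (fixedVectors π K).starProjection (π k x) = (fixedVectors π K).starProjection x := by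
  refine Submodule.eq_starProjection_of_mem_of_inner_eq_zero
    (K := fixedVectors π K) (Submodule.starProjection_apply_mem _ x) fun y hy => ?_
  have hy' : π k⁻¹ y = y := hy _ (K.inv_mem hk)
  have h := (fixedVectors π K).starProjection_inner_eq_zero x y hy
  rw [inner_sub_left] at h ⊢
  have hx : ⟪π k x, y⟫_ℂ = ⟪x, y⟫_ℂ := by
    rw [← inv_inv k, inner_apply_inv (π := π), hy']
  rw [hx, h]

/-- The vector of least norm in the closed affine hull of the orbit `K ξ` is fixed by `K`, hence
equals the projection of `ξ` to the fixed vectors; the hypothesis bounds squared norms below on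
that hull. -/
theorem le_norm_sq_starProjection_fixedVectors [CompleteSpace H] (π : G →* (H ≃ₗᵢ[ℂ] H))
    (K : Subgroup G) (ξ : H) {c : ℝ}
    (hc : ∀ a : K →₀ ℂ, c * ‖a.sum fun _ x => x‖ ^ 2 ≤ ‖a.sum fun k x => x • π k ξ‖ ^ 2) :
    c ≤ ‖(fixedVectors π K).starProjection ξ‖ ^ 2 := by
  set P := (fixedVectors π K).starProjection
  let A := Finsupp.linearCombination ℂ fun k : K => π k ξ
  let σ : (K →₀ ℂ) →ₗ[ℂ] ℂ := Finsupp.linearCombination ℂ fun _ => 1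
  let C : Set H := A '' {a | σ a = 1}
  have hconv : Convex ℝ (closure C) := by
    refine Convex.closure ?_
    refine Convex.is_linear_image (f := A) ?_ (A.restrictScalars ℝ).isLinear
    intro x hx y hy s t _ _ hst
    have hx : σ x = 1 := hx
    have hy : σ y = 1 := hy
    change (σ.restrictScalars ℝ) _ = 1
    rw [map_add, map_smul, map_smul]
    simp only [LinearMap.restrictScalars_apply, hx, hy, ← add_smul, hst, one_smul]
  have hξ : ξ ∈ C := ⟨Finsupp.single 1 1, by simp [σ], by simp [A]⟩
  have hinv (k : K) : Set.MapsTo (π k) (closure C) (closure C) := by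
    refine Set.MapsTo.closure ?_ (π k).continuous
    rintro _ ⟨a, ha, rfl⟩
    refine ⟨a.mapDomain (k * ·), ?_, ?_⟩
    · change σ _ = 1
      have ha : σ a = 1 := ha
      rw [← ha]
      simp [σ, Finsupp.linearCombination_mapDomain, Function.comp_def]
    · simp only [A]
      rw [Finsupp.linearCombination_mapDomain, Finsupp.linearCombination_apply,
        Finsupp.linearCombination_apply, map_finsuppSum]
      simp
  have hPC : ∀ x ∈ closure C, P x = P ξ := by
    intro x hx
    refine closure_minimal (t := {x | P x = P ξ}) ?_ (isClosed_eq P.continuous continuous_const) hx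
    rintro _ ⟨a, ha, rfl⟩
    have ha : σ a = 1 := ha
    change P (A a) = P ξ
    simp only [A, Finsupp.linearCombination_apply, map_finsuppSum, map_smul, P,
      starProjection_fixedVectors_apply π K (Subtype.prop _)]
    have : (a.sum fun _ x => x) = 1 := by
      rw [← ha]; simp [σ, Finsupp.linearCombination_apply]
    rw [Finsupp.sum, ← Finset.sum_smul]
    exact (congrArg (· • P ξ) this).trans (one_smul _ _)
  have hcC : ∀ x ∈ closure C, c ≤ ‖x‖ ^ 2 := by
    intro x hx
    refine closure_minimal (t := {x | c ≤ ‖x‖ ^ 2}) ?_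
      (isClosed_le continuous_const (by fun_prop)) hx
    rintro _ ⟨a, ha, rfl⟩
    have ha : σ a = 1 := ha
    have h := hc a
    have : (a.sum fun _ x => x) = 1 := by
      rw [← ha]; simp [σ, Finsupp.linearCombination_apply]
    rw [this] at h
    simpa [A, Finsupp.linearCombination_apply] using h
  let _ : InnerProductSpace ℝ H := InnerProductSpace.rclikeToReal ℂ H
  obtain ⟨η, hη, hmin⟩ := exists_norm_eq_iInf_of_complete_convex ⟨ξ, subset_closure hξ⟩
    isClosed_closure.isComplete hconv 0
  rw [norm_eq_iInf_iff_real_inner_le_zero hconv hη] at hmin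
  have hfix : η ∈ fixedVectors π K := by
    intro k hk
    have h := hmin _ (hinv ⟨k, hk⟩ hη)
    have hle := real_inner_le_norm η (π k η)
    simp only [LinearIsometryEquiv.norm_map, zero_sub, inner_neg_left, inner_sub_right,
      real_inner_self_eq_norm_sq] at h hle
    refine (eq_of_norm_le_re_inner_eq_norm_sq (𝕜 := ℝ) (by simp) ?_)
    rw [RCLike.re_to_real, real_inner_comm]
    linarith
  have := hcC η hη
  rwa [← Submodule.starProjection_eq_self_iff.2 hfix, hPC η hη] at this

end Fixed

/-! ### The representation attached to a trace -/

section Tracial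

theorem ext_inner_of_total {𝕜 E ι : Type*} [RCLike 𝕜]
    [NormedAddCommGroup E] [InnerProductSpace 𝕜 E] {v : ι → E}
    (hv : (Submodule.span 𝕜 (Set.range v)).topologicalClosure = ⊤) {x y : E}
    (h : ∀ i, ⟪v i, x⟫_𝕜 = ⟪v i, y⟫_𝕜) : x = y := by
  refine ext_inner_right 𝕜 fun z => ?_
  have := clm_eq_of_total hv (innerSL 𝕜 x) (innerSL 𝕜 y) fun i => by
    rw [innerSL_apply_apply, innerSL_apply_apply, ← inner_conj_symm, h, inner_conj_symm]
  exact DFunLike.congr_fun this z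

/-- The complex multiples of a total family are total over `ℝ`; this allows conjugate-linear
isometries to be constructed as real-linear ones. -/
theorem span_real_range_smul_total {H ι : Type*} [NormedAddCommGroup H] [InnerProductSpace ℂ H]
    {v : ι → H} (hv : (Submodule.span ℂ (Set.range v)).topologicalClosure = ⊤) :
    (Submodule.span ℝ (Set.range fun p : ℂ × ι => p.1 • v p.2)).topologicalClosure = ⊤ := by
  rw [← Submodule.dense_iff_topologicalClosure_eq_top] at hv ⊢
  refine hv.mono fun x hx => ?_
  obtain ⟨a, rfl⟩ := Finsupp.mem_span_range_iff_exists_finsupp.1 hx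
  exact Submodule.sum_mem _ fun i _ => Submodule.subset_span ⟨(a i, i), rfl⟩

/-- The vector functional of `v 1` is tracial on the operators commuting with the right translations
`ρ`. The conjugate-linear isometry `J : v g ↦ v g⁻¹`, whose existence rests on the conjugation
invariance of `φ`, satisfies `J (T (v 1)) = T† (v 1)` for every such operator `T`. -/
theorem re_inner_comp_comm_of_commute {G H : Type*} [Group G] [NormedAddCommGroup H]
    [InnerProductSpace ℂ H] [CompleteSpace H] {φ : G → ℂ}
    (hφ : ∀ g h, φ (h * g * h⁻¹) = φ g) {v : G → H} (hv : ∀ g h, ⟪v g, v h⟫_ℂ = φ (g⁻¹ * h))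
    (htot : (Submodule.span ℂ (Set.range v)).topologicalClosure = ⊤)
    {ρ : Gᵐᵒᵖ →* (H ≃ₗᵢ[ℂ] H)} (hρ : ∀ k g, ρ k (v g) = v (k • g)) {S T : H →L[ℂ] H}
    (hS : ∀ k x, S (ρ k x) = ρ k (S x)) (hT : ∀ k x, T (ρ k x) = ρ k (T x)) :
    (⟪v 1, S (T (v 1))⟫_ℂ).re = (⟪v 1, T (S (v 1))⟫_ℂ).re := by
  let _ : InnerProductSpace ℝ H := InnerProductSpace.rclikeToReal ℂ H
  have hreal (x y : H) : ⟪x, y⟫_ℝ = (⟪x, y⟫_ℂ).re := rfl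
  have htot' := span_real_range_smul_total htot
  have hcomm (a b : G) : φ (a * b) = φ (b * a) := by
    rw [← hφ (a * b) b]; congr 1; group
  have hconj (g : G) : φ g⁻¹ = star (φ g) := by
    have h := inner_conj_symm (𝕜 := ℂ) (v g) (v 1)
    rw [hv, hv] at h
    simpa using h.symm
  -- `J` is conjugate-linear, so it is constructed as an isometry of the underlying real space.
  obtain ⟨J, hJ⟩ := exists_linearIsometry_of_inner_eq (𝕜 := ℝ)
    (fun p : ℂ × G => p.1 • v p.2) (fun p : ℂ × G => star p.1 • v p.2⁻¹)
    (fun p q => by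
      have : φ (p.2 * q.2⁻¹) = star (φ (p.2⁻¹ * q.2)) := by
        rw [← hconj, hcomm]; simp
      simp only [hreal, inner_smul_left, inner_smul_right, hv, inv_inv, this]
      rw [← Complex.conj_re]
      simp) htot'
  have hJJ (x : H) : J (J x) = x := by
    have := clm_eq_of_total htot' (J.toContinuousLinearMap.comp J.toContinuousLinearMap)
      (ContinuousLinearMap.id ℝ H) (fun p => by
        change J (J (p.1 • v p.2)) = p.1 • v p.2
        have h1 := hJ p
        have h2 := hJ (star p.1, p.2⁻¹)
        simp only [inv_inv, star_star] at h1 h2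
        rw [h1, h2])
    exact DFunLike.congr_fun this x
  have hJsymm (x y : H) : ⟪J x, y⟫_ℝ = ⟪J y, x⟫_ℝ := by
    rw [← J.inner_map_map, hJJ, real_inner_comm]
  have key {T : H →L[ℂ] H} (hT : ∀ k x, T (ρ k x) = ρ k (T x)) :
      J (T (v 1)) = T.adjoint (v 1) := by
    refine ext_inner_of_total htot' fun p => ?_
    have e1 : v p.2 = ρ (MulOpposite.op p.2) (v 1) := by simp [hρ]
    have e2 : v p.2⁻¹ = ρ (MulOpposite.op p.2)⁻¹ (v 1) := by simp [hρ, ← MulOpposite.op_inv]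
    have e3 : ⟪T (v p.2), v 1⟫_ℂ = ⟪T (v 1), v p.2⁻¹⟫_ℂ := by
      rw [e1, hT, e2, ← inner_apply_inv (π := ρ), inv_inv]
    rw [real_inner_comm, hJsymm, hJ]
    simp only [hreal]
    rw [ContinuousLinearMap.adjoint_inner_right, map_smul, inner_smul_left, inner_smul_left, e3,
      ← inner_conj_symm (T (v 1)), ← Complex.conj_re]
    simp
  calc (⟪v 1, S (T (v 1))⟫_ℂ).re = ⟪J (S (v 1)), T (v 1)⟫_ℝ := by
        rw [key hS, hreal, ContinuousLinearMap.adjoint_inner_left]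
    _ = ⟪J (T (v 1)), S (v 1)⟫_ℝ := hJsymm _ _
    _ = _ := by rw [key hT, hreal, ContinuousLinearMap.adjoint_inner_left]

/-- The GNS representation `π` of a trace, together with an operator ring `M`, the commutant of the
right translations, on which the vector functional of `ξ` is tracial and which contains the
projections to the vectors fixed by subgroups. -/
theorem IsTrace.exists_tracial_rep {G : Type u} [Group G] {φ : G → ℂ} (hφ : IsTrace φ) :
    ∃ (H : Type u) (_ : NormedAddCommGroup H) (_ : InnerProductSpace ℂ H) (_ : CompleteSpace H)
      (π : G →* (H ≃ₗᵢ[ℂ] H)) (ξ : H) (M : Subring (H →L[ℂ] H)),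
      (∀ g h, ⟪π g ξ, π h ξ⟫_ℂ = φ (g⁻¹ * h)) ∧
      (∀ S ∈ M, ∀ T ∈ M, (⟪ξ, S (T ξ)⟫_ℂ).re = (⟪ξ, T (S ξ)⟫_ℂ).re) ∧
      ∀ K : Subgroup G, (fixedVectors π K).starProjection ∈ M := by
  obtain ⟨H, _, _, _, v, hv, htot⟩ :=
    exists_hilbert_of_posSemidef (isPosDef_iff_posSemidef.1 hφ.posDef)
  simp only [Matrix.of_apply] at hv
  obtain ⟨π, hπ⟩ := exists_unitaryRep_of_inner_smul_eq (K := G) v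
    (fun k i j => by simp [hv, mul_assoc]) htot
  obtain ⟨ρ, hρ⟩ := exists_unitaryRep_of_inner_smul_eq (K := Gᵐᵒᵖ) v
    (fun k i j => by
      rw [hv, hv, ← hφ.conj_invariant (i⁻¹ * j) k.unop⁻¹]
      simp [mul_assoc, MulOpposite.smul_eq_mul_unop]) htot
  have hπ1 (g : G) : π g (v 1) = v g := by simp [hπ]
  refine ⟨H, inferInstance, inferInstance, inferInstance, π, v 1,
    Subring.centralizer (Set.range fun k => ((ρ k).toContinuousLinearEquiv : H →L[ℂ] H)),
    fun g h => by rw [hπ1, hπ1, hv], fun S hS T hT => ?_, fun K => ?_⟩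
  · have hcomm {S : H →L[ℂ] H} (hS : S ∈ Subring.centralizer
        (Set.range fun k => ((ρ k).toContinuousLinearEquiv : H →L[ℂ] H))) (k x) :
        S (ρ k x) = ρ k (S x) :=
      (DFunLike.congr_fun (Subring.mem_centralizer_iff.1 hS _ ⟨k, rfl⟩) x).symm
    exact re_inner_comp_comm_of_commute hφ.conj_invariant hv htot hρ (hcomm hS) (hcomm hT)
  · have hπρ (g : G) (k : Gᵐᵒᵖ) (x : H) : π g (ρ k x) = ρ k (π g x) := by
      have := clm_eq_of_total htot
        (((π g).toContinuousLinearEquiv : H →L[ℂ] H).comp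
          ((ρ k).toContinuousLinearEquiv : H →L[ℂ] H))
        (((ρ k).toContinuousLinearEquiv : H →L[ℂ] H).comp
          ((π g).toContinuousLinearEquiv : H →L[ℂ] H))
        (fun i => by simp [hπ, hρ, mul_assoc])
      exact DFunLike.congr_fun this x
    have hmap (k : Gᵐᵒᵖ) {x : H} (hx : x ∈ fixedVectors π K) : ρ k x ∈ fixedVectors π K :=
      fun g hg => by rw [hπρ, hx g hg]
    rw [Subring.mem_centralizer_iff]
    rintro _ ⟨k, rfl⟩
    ext x
    change ρ k ((fixedVectors π K).starProjection x) = (fixedVectors π K).starProjection (ρ k x)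
    refine (Submodule.eq_starProjection_of_mem_of_inner_eq_zero (K := fixedVectors π K)
      (hmap k (Submodule.starProjection_apply_mem _ x)) fun y hy => ?_).symm
    rw [← map_sub]
    nth_rewrite 1 [← inv_inv k]
    rw [inner_apply_inv (π := ρ)]
    exact (fixedVectors π K).starProjection_inner_eq_zero x _ (hmap _ hy)

/-- If a trace dominates the constants `c` on `K` and `d` on `L`, it dominates `c + d - 1` on
`K ⊔ L`. This fails for positive definite functions that are not conjugation invariant. -/
theorem IsTrace.isPosDef_sup {G : Type u} [Group G] {φ : G → ℂ} (hφ : IsTrace φ)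
    {K L : Subgroup G} {c d : ℝ} (hc : IsPosDef fun k : K => φ k - c)
    (hd : IsPosDef fun l : L => φ l - d) :
    IsPosDef fun g : (K ⊔ L : Subgroup G) => φ g - (c + d - 1 : ℝ) := by
  obtain ⟨H, _, _, _, π, ξ, M, hπ, hM, hP⟩ := hφ.exists_tracial_rep
  have hiff (K : Subgroup G) (c : ℝ) : (IsPosDef fun k : K => φ k - c) ↔
      ∀ a : K →₀ ℂ, c * ‖a.sum fun _ x => x‖ ^ 2 ≤ ‖a.sum fun k x => x • π k ξ‖ ^ 2 := by
    rw [isPosDef_iff_posSemidef, ← posSemidef_inner_sub_const_iff]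
    simp only [hπ, Subgroup.coe_mul, Subgroup.coe_inv]
  rw [hiff] at hc hd ⊢
  intro a
  have h1 := le_norm_sq_starProjection_fixedVectors π K ξ hc
  have h2 := le_norm_sq_starProjection_fixedVectors π L ξ hd
  have : CompleteSpace (fixedVectors π K ⊓ fixedVectors π L : Submodule ℂ H) := by
    rw [← fixedVectors_sup]; infer_instance
  have h3 := norm_sq_starProjection_add_le M ξ hM _ _ (hP K) (hP L)
  have hξ : ‖ξ‖ ^ 2 = 1 := by
    have h := hπ 1 1
    rw [inv_one, mul_one, hφ.map_one, _root_.map_one π] at h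
    have h : ⟪ξ, ξ⟫_ℂ = 1 := h
    rw [← inner_self_eq_norm_sq (𝕜 := ℂ), h, RCLike.one_re]
  have h4 : ‖(fixedVectors π (K ⊔ L)).starProjection ξ‖ =
      ‖(fixedVectors π K ⊓ fixedVectors π L).starProjection ξ‖ := by
    congr! 3
    exact fixedVectors_sup π K L
  rw [← h4, hξ] at h3
  set P := (fixedVectors π (K ⊔ L)).starProjection
  have h5 : P (a.sum fun k x => x • π k ξ) = (a.sum fun _ x => x) • P ξ := by
    simp only [map_finsuppSum, map_smul, P,
      starProjection_fixedVectors_apply π (K ⊔ L) (Subtype.prop _)]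
    rw [Finsupp.sum, Finsupp.sum, Finset.sum_smul]
  calc (c + d - 1) * ‖a.sum fun _ x => x‖ ^ 2 ≤ ‖P ξ‖ ^ 2 * ‖a.sum fun _ x => x‖ ^ 2 := by
        gcongr; linarith
    _ = ‖P (a.sum fun k x => x • π k ξ)‖ ^ 2 := by rw [h5, norm_smul, mul_pow, mul_comm]
    _ ≤ _ := pow_le_pow_left₀ (norm_nonneg _) (Submodule.norm_starProjection_apply_le _ _) 2

end Tracial

/-! ### The compact convex set of traces -/

section Traces

variable {G : Type*} [Group G] {φ ψ : G → ℂ}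

theorem IsPosDef.add (hφ : IsPosDef φ) (hψ : IsPosDef ψ) : IsPosDef (φ + ψ) :=
  fun n g => (hφ n g).add (hψ n g)

theorem IsPosDef.smul (hφ : IsPosDef φ) {r : ℝ} (hr : 0 ≤ r) : IsPosDef (r • φ) :=
  fun n g => (hφ n g).smul hr

theorem isPosDef_const {r : ℝ} (hr : 0 ≤ r) : IsPosDef fun _ : G => (r : ℂ) := by
  have h1 : IsPosDef fun _ : G => (1 : ℂ) := fun n g => by
    convert Matrix.posSemidef_vecMulVec_self_star (fun _ : Fin n => (1 : ℂ)) using 1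
    ext i j
    simp [Matrix.vecMulVec_apply]
  convert h1.smul hr using 1
  ext; simp

theorem IsPosDef.comp {G' : Type*} [Group G'] (hφ : IsPosDef φ) (f : G' →* G) :
    IsPosDef (φ ∘ f) := fun n g => by
  simpa using hφ n (f ∘ g)

theorem isClosed_setOf_isPosDef : IsClosed {φ : G → ℂ | IsPosDef φ} := by
  have : {φ : G → ℂ | IsPosDef φ} =
      (⋂ (g : G) (h : G), {φ : G → ℂ | star (φ (h⁻¹ * g)) = φ (g⁻¹ * h)}) ∩
      ⋂ x : G →₀ ℂ,
        {φ : G → ℂ | 0 ≤ x.sum fun g a => x.sum fun h b => star a * φ (g⁻¹ * h) * b} := by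
    ext φ
    simp only [Set.mem_ofPred_eq, isPosDef_iff_posSemidef, Matrix.PosSemidef, Set.mem_inter_iff,
      Set.mem_iInter, Matrix.IsHermitian.ext_iff, Matrix.of_apply]
  rw [this]
  refine IsClosed.inter ?_ ?_
  · exact isClosed_iInter fun g => isClosed_iInter fun h => isClosed_eq (by fun_prop) (by fun_prop)
  · refine isClosed_iInter fun x => isClosed_le continuous_const ?_
    simp only [Finsupp.sum]
    fun_prop

theorem IsPosDef.norm_le (hφ : IsPosDef φ) (g : G) : ‖φ g‖ ≤ (φ 1).re := by
  obtain ⟨H, _, _, _, v, hv, -⟩ := exists_hilbert_of_posSemidef (isPosDef_iff_posSemidef.1 hφ)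
  simp only [Matrix.of_apply] at hv
  have hn (g : G) : ‖v g‖ ^ 2 = (φ 1).re := by
    rw [← inner_self_eq_norm_sq (𝕜 := ℂ), hv, inv_mul_cancel]; rfl
  have hn' : ‖v g‖ = ‖v 1‖ :=
    (sq_eq_sq₀ (norm_nonneg _) (norm_nonneg _)).1 ((hn g).trans (hn 1).symm)
  calc ‖φ g‖ = ‖⟪v 1, v g⟫_ℂ‖ := by simp [hv]
    _ ≤ ‖v 1‖ * ‖v g‖ := norm_inner_le_norm _ _
    _ = (φ 1).re := by rw [hn', ← sq, hn]

theorem IsTrace.norm_le_one (hφ : IsTrace φ) (g : G) : ‖φ g‖ ≤ 1 := by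
  simpa [hφ.map_one] using hφ.posDef.norm_le g

theorem IsTrace.re_le_one (hφ : IsTrace φ) (g : G) : (φ g).re ≤ 1 :=
  (Complex.re_le_norm _).trans (hφ.norm_le_one g)

theorem IsTrace.norm_sub_one_sq_le (hφ : IsTrace φ) (g : G) :
    ‖φ g - 1‖ ^ 2 ≤ 2 * (1 - (φ g).re) := by
  have h := pow_le_pow_left₀ (norm_nonneg _) (hφ.norm_le_one g) 2
  rw [← Complex.normSq_eq_norm_sq, Complex.normSq_apply] at h ⊢
  simp only [Complex.sub_re, Complex.sub_im, Complex.one_re, Complex.one_im]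
  linarith

theorem IsTrace.eq_one_of_re_eq_one (hφ : IsTrace φ) {g : G} (h : (φ g).re = 1) : φ g = 1 := by
  have := hφ.norm_sub_one_sq_le g
  rw [h, sub_self, mul_zero] at this
  exact sub_eq_zero.1 (norm_eq_zero.1 (pow_eq_zero_iff two_ne_zero |>.1
    (le_antisymm this (by positivity))))

theorem isTrace_one : IsTrace fun _ : G => (1 : ℂ) :=
  ⟨by simpa using isPosDef_const (G := G) zero_le_one, fun _ _ => rfl, rfl⟩

theorem IsTrace.comp {G' : Type*} [Group G'] (hφ : IsTrace φ) (f : G' →* G) : IsTrace (φ ∘ f) :=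
  ⟨hφ.posDef.comp f, fun g h => by simp [hφ.conj_invariant], by simp [hφ.map_one]⟩

theorem convex_traces (G : Type*) [Group G] : Convex ℝ (traces G) := by
  intro φ hφ ψ hψ a b ha hb hab
  refine ⟨(hφ.posDef.smul ha).add (hψ.posDef.smul hb), fun g h => ?_, ?_⟩
  · simp [hφ.conj_invariant, hψ.conj_invariant]
  · simp only [Pi.add_apply, Pi.smul_apply, hφ.map_one, hψ.map_one, ← add_smul, hab, one_smul]

theorem isCompact_traces (G : Type*) [Group G] : IsCompact (traces G) := by
  refine (isCompact_univ_pi fun _ : G => isCompact_closedBall (0 : ℂ) 1).of_isClosed_subset ?_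
    fun φ hφ g _ => by simpa using hφ.norm_le_one g
  have : traces G = {φ : G → ℂ | IsPosDef φ} ∩
      (⋂ (g : G) (h : G), {φ : G → ℂ | φ (h * g * h⁻¹) = φ g}) ∩ {φ : G → ℂ | φ 1 = 1} := by
    ext φ
    simp only [Set.mem_inter_iff, Set.mem_iInter, Set.mem_ofPred_eq]
    exact ⟨fun h => ⟨⟨h.1, h.2⟩, h.3⟩, fun h => ⟨h.1.1, h.1.2, h.2⟩⟩
  rw [this]
  refine (isClosed_setOf_isPosDef.inter ?_).inter (isClosed_eq (by fun_prop) (by fun_prop))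
  exact isClosed_iInter fun g => isClosed_iInter fun h => isClosed_eq (by fun_prop) (by fun_prop)

theorem one_mem_characters (G : Type*) [Group G] : (fun _ => 1) ∈ characters G := by
  refine mem_extremePoints_iff_left.2 ⟨isTrace_one, fun φ hφ ψ hψ h => ?_⟩
  obtain ⟨a, b, ha, hb, hab, h⟩ := h
  ext g
  refine hφ.eq_one_of_re_eq_one (le_antisymm (hφ.re_le_one g) ?_)
  have h' := congrArg Complex.re (congrFun h g)
  simp only [Pi.add_apply, Pi.smul_apply, Complex.add_re, Complex.smul_re, Complex.one_re,
    smul_eq_mul] at h'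
  have := hψ.re_le_one g
  by_contra! hlt
  nlinarith

end Traces

/-! ### Property (ET) and rigid subgroups -/

section ET

variable {G : Type*} [Group G]

/-- Under property (ET) every trace `φ` has a positive definite difference with a constant `c` whose
distance from `1` is controlled linearly by the values of `φ` on a fixed finite set. -/
theorem PropertyET.exists_weight (h : PropertyET G) : ∃ (F : Finset G) (δ : ℝ), 0 < δ ∧
    ∀ φ : G → ℂ, IsTrace φ → ∃ c : ℝ, IsPosDef (fun g => φ g - c) ∧
      (1 - c) * δ ≤ ∑ g ∈ F, (1 - (φ g).re) := by
  obtain ⟨U, hU, hUch⟩ := h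
  have h1U : (fun _ => 1) ∈ U := (hUch.symm ▸ Set.mem_singleton _ : _ ∈ U ∩ characters G).1
  obtain ⟨F, ε, hε, hFU⟩ : ∃ (F : Finset G) (ε : ℝ), 0 < ε ∧
      ∀ φ : G → ℂ, (∀ g ∈ F, ‖φ g - 1‖ < ε) → φ ∈ U := by
    obtain ⟨F, u, hu, hFu⟩ := isOpen_pi_iff.1 hU _ h1U
    have hev : ∀ᶠ ε in 𝓝[>] (0 : ℝ), ∀ g ∈ F, Metric.ball (1 : ℂ) ε ⊆ u g :=
      (Filter.eventually_all_finset F).2 fun g hg => by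
        obtain ⟨r, hr, hru⟩ := Metric.isOpen_iff.1 (hu g hg).1 1 (hu g hg).2
        filter_upwards [Ioo_mem_nhdsGT hr] with ε hε
        exact (Metric.ball_subset_ball hε.2.le).trans hru
    obtain ⟨ε, hε, hε0⟩ := (hev.and self_mem_nhdsWithin).exists
    exact ⟨F, ε, hε0, fun φ hφ => hFu fun g hg => hε g hg (by simpa [dist_eq_norm] using hφ g hg)⟩
  refine ⟨F, ε ^ 2 / 2, by positivity, ?_⟩
  set δ := ε ^ 2 / 2
  -- The conditions on `(c, φ)` are closed and jointly convex, so the traces admitting a suitable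
  -- `c` form a compact convex set, and it suffices to treat characters.
  let A : Set (ℝ × (G → ℂ)) := {p | p.1 ∈ Set.Icc (0 : ℝ) 1 ∧ p.2 ∈ traces G ∧
    IsPosDef (fun g => p.2 g - p.1) ∧ (1 - p.1) * δ ≤ ∑ g ∈ F, (1 - (p.2 g).re)}
  have hAc : IsCompact A := by
    refine (isCompact_Icc.prod (isCompact_traces G)).of_isClosed_subset ?_
      fun p hp => ⟨hp.1, hp.2.1⟩
    refine (isClosed_Icc.preimage continuous_fst).inter
      (((isCompact_traces G).isClosed.preimage continuous_snd).inter (IsClosed.inter ?_ ?_))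
    · exact isClosed_setOf_isPosDef.preimage
        (f := fun (p : ℝ × (G → ℂ)) g => p.2 g - (p.1 : ℂ)) (by fun_prop)
    · exact isClosed_le (f := fun p : ℝ × (G → ℂ) => (1 - p.1) * δ)
        (g := fun p => ∑ g ∈ F, (1 - (p.2 g).re)) (by fun_prop) (by fun_prop)
  have hAconv : Convex ℝ A := by
    rintro ⟨c, φ⟩ ⟨hc, hφ, hcφ, hcF⟩ ⟨d, ψ⟩ ⟨hd, hψ, hdψ, hdF⟩ a b ha hb hab
    refine ⟨convex_Icc 0 1 hc hd ha hb hab, convex_traces G hφ hψ ha hb hab, ?_, ?_⟩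
    · convert (hcφ.smul ha).add (hdψ.smul hb) using 1
      ext g
      simp; ring
    · have e : ∑ g ∈ F, (1 - ((a • φ + b • ψ) g).re) =
          a * ∑ g ∈ F, (1 - (φ g).re) + b * ∑ g ∈ F, (1 - (ψ g).re) := by
        rw [Finset.mul_sum, Finset.mul_sum, ← Finset.sum_add_distrib]
        refine Finset.sum_congr rfl fun g _ => ?_
        simp only [Pi.add_apply, Pi.smul_apply, Complex.add_re, Complex.smul_re, smul_eq_mul]
        linear_combination (-1 : ℝ) * hab
      change (1 - (a * c + b * d)) * δ ≤ ∑ g ∈ F, (1 - ((a • φ + b • ψ) g).re)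
      rw [e]
      have := add_le_add (mul_le_mul_of_nonneg_left hcF ha) (mul_le_mul_of_nonneg_left hdF hb)
      refine le_trans (le_of_eq ?_) this
      simp only
      linear_combination (-δ) * hab
  have hext : characters G ⊆ Prod.snd '' A := by
    intro χ hχ
    have hχt : IsTrace χ := hχ.1
    by_cases hχU : χ ∈ U
    · have : χ = fun _ => 1 := by
        have : χ ∈ U ∩ characters G := ⟨hχU, hχ⟩
        rwa [hUch] at this
      refine ⟨(1, χ), ⟨⟨zero_le_one, le_rfl⟩, hχ.1, ?_, ?_⟩, rfl⟩
      · subst this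
        simpa using isPosDef_const (G := G) le_rfl
      · subst this
        simp
    · refine ⟨(0, χ), ⟨⟨le_rfl, zero_le_one⟩, hχ.1, by simpa using hχt.posDef, ?_⟩, rfl⟩
      obtain ⟨g, hg, hge⟩ : ∃ g ∈ F, ε ≤ ‖χ g - 1‖ := by
        by_contra! hlt
        exact hχU (hFU χ hlt)
      have h1 := pow_le_pow_left₀ hε.le hge 2
      have h2 := hχt.norm_sub_one_sq_le g
      calc (1 - (0 : ℝ)) * δ ≤ 1 - (χ g).re := by simp only [δ]; linarith
        _ ≤ ∑ g ∈ F, (1 - (χ g).re) := Finset.single_le_sum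
          (f := fun g => 1 - (χ g).re) (fun g _ => sub_nonneg.2 (hχt.re_le_one g)) hg
  intro φ hφ
  have hφA : φ ∈ Prod.snd '' A := by
    have : φ ∈ traces G := hφ
    rw [← closure_convexHull_extremePoints (isCompact_traces G) (convex_traces G)] at this
    refine closure_minimal (convexHull_min hext ?_) (hAc.image continuous_snd).isClosed this
    exact hAconv.linear_image (LinearMap.snd ℝ ℝ (G → ℂ))
  obtain ⟨⟨c, φ⟩, ⟨-, -, hc, hcF⟩, rfl⟩ := hφA
  exact ⟨c, hc, hcF⟩

/-- A subgroup `K` is rigid if every trace `φ` on the ambient group `G` dominates on `K`, in the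
sense of positive definiteness, a real constant `c` with `1 - c ≤ C * ∑ g ∈ F, (1 - Re φ g)`, where
`C` and the finite set `F ⊆ G` do not depend on `φ`. There is no lower bound on `c`, so the
condition is only meaningful for traces close to `1` on `F`. -/
def IsRigid (K : Subgroup G) : Prop :=
  ∃ (F : Finset G) (C : ℝ), 0 ≤ C ∧ ∀ φ : G → ℂ, IsTrace φ → ∃ c : ℝ,
    IsPosDef (fun k : K => φ k - c) ∧ 1 - c ≤ C * ∑ g ∈ F, (1 - (φ g).re)

theorem PropertyET.isRigid_range {G' : Type*} [Group G'] (h : PropertyET G') (f : G' →* G) :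
    IsRigid f.range := by
  classical
  obtain ⟨F, δ, hδ, hF⟩ := h.exists_weight
  -- The factor `F.card` is needed because `f` may identify elements of `F`.
  refine ⟨F.image f, F.card * δ⁻¹, by positivity, fun φ hφ => ?_⟩
  obtain ⟨c, hc, hcF⟩ := hF _ (hφ.comp f)
  refine ⟨c, fun n g => ?_, ?_⟩
  · choose h hh using fun i => (g i).2
    convert hc n h using 1
    ext i j
    simp [hh]
  · have hle : ∑ g ∈ F, (1 - ((φ ∘ f) g).re) ≤ F.card * ∑ g ∈ F.image f, (1 - (φ g).re) := by
      rw [← nsmul_eq_mul]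
      exact Finset.sum_le_card_nsmul _ _ _ fun g hg => Finset.single_le_sum
        (f := fun g => 1 - (φ g).re) (fun g _ => sub_nonneg.2 (hφ.re_le_one g))
        (Finset.mem_image_of_mem f hg)
    rw [mul_right_comm, ← div_eq_mul_inv, le_div_iff₀ hδ]
    exact hcF.trans hle

theorem isRigid_bot : IsRigid (⊥ : Subgroup G) := by
  refine ⟨∅, 0, le_rfl, fun φ hφ => ⟨1, ?_, by simp⟩⟩
  convert isPosDef_const (G := (⊥ : Subgroup G)) le_rfl using 1
  ext ⟨g, hg⟩
  obtain rfl := Subgroup.mem_bot.1 hg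
  simp [hφ.map_one]

theorem IsRigid.sup {K L : Subgroup G} (hK : IsRigid K) (hL : IsRigid L) : IsRigid (K ⊔ L) := by
  classical
  obtain ⟨F₁, C₁, hC₁, h₁⟩ := hK
  obtain ⟨F₂, C₂, hC₂, h₂⟩ := hL
  refine ⟨F₁ ∪ F₂, C₁ + C₂, add_nonneg hC₁ hC₂, fun φ hφ => ?_⟩
  obtain ⟨c, hc, hcF⟩ := h₁ φ hφ
  obtain ⟨d, hd, hdF⟩ := h₂ φ hφ
  refine ⟨c + d - 1, hφ.isPosDef_sup hc hd, ?_⟩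
  have hmono {S : Finset G} (hS : S ⊆ F₁ ∪ F₂) :
      ∑ g ∈ S, (1 - (φ g).re) ≤ ∑ g ∈ F₁ ∪ F₂, (1 - (φ g).re) :=
    Finset.sum_le_sum_of_subset_of_nonneg hS fun g _ _ => sub_nonneg.2 (hφ.re_le_one g)
  have := mul_le_mul_of_nonneg_left (hmono Finset.subset_union_left) hC₁
  have := mul_le_mul_of_nonneg_left (hmono Finset.subset_union_right) hC₂
  rw [add_mul]
  linarith

theorem isRigid_iSup {ι : Type*} [Finite ι] {K : ι → Subgroup G} (h : ∀ i, IsRigid (K i)) :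
    IsRigid (⨆ i, K i) := by
  have := Fintype.ofFinite ι
  rw [← Finset.sup_univ_eq_iSup]
  exact Finset.sup_induction isRigid_bot (fun _ h₁ _ h₂ => h₁.sup h₂) fun i _ => h i

theorem IsRigid.propertyET (h : IsRigid (⊤ : Subgroup G)) : PropertyET G := by
  obtain ⟨F, C, hC, h⟩ := h
  refine ⟨{φ | C * ∑ g ∈ F, (1 - (φ g).re) < 1}, isOpen_lt (by fun_prop) (by fun_prop),
    Set.eq_singleton_iff_unique_mem.2 ⟨⟨by simp, one_mem_characters G⟩, ?_⟩⟩
  rintro φ ⟨hφF, hφ⟩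
  have hφF : C * ∑ g ∈ F, (1 - (φ g).re) < 1 := hφF
  have hφt : IsTrace φ := hφ.1
  obtain ⟨c, hc, hcF⟩ := h φ hφt
  have hc : IsPosDef fun g => φ g - c := hc.comp (Subgroup.topEquiv (G := G)).symm.toMonoidHom
  have hc0 : 0 < c := by linarith
  have hle (g : G) : ‖φ g - c‖ ≤ 1 - c := by simpa [hφt.map_one] using hc.norm_le g
  have hc1 : 0 ≤ 1 - c := (norm_nonneg _).trans (hle 1)
  -- For `c < 1`, `φ` is a proper convex combination of `1` and the trace `(φ - c) / (1 - c)`.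
  rcases hc1.eq_or_lt with hc1 | hc1
  · ext g
    have := hle g
    rw [← hc1, norm_le_zero_iff, sub_eq_zero] at this
    rw [this, ← sub_eq_zero.1 hc1.symm, Complex.ofReal_one]
  · have hψ : IsTrace ((1 - c)⁻¹ • fun g => φ g - (c : ℂ)) := by
      refine ⟨hc.smul (inv_nonneg.2 hc1.le), fun g h => by simp [hφt.conj_invariant], ?_⟩
      have : (1 : ℂ) - c ≠ 0 := by exact_mod_cast hc1.ne'
      simp [hφt.map_one, this]
    refine ((mem_extremePoints_iff_left.1 hφ).2 _ isTrace_one _ hψ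
      ⟨c, 1 - c, hc0, hc1, by ring, ?_⟩).symm
    rw [smul_inv_smul₀ hc1.ne']
    ext g
    simp

/-- A group generated by finitely many homomorphic images of groups with property (ET) has property
(ET). -/
theorem propertyET_of_iSup_range_eq_top {ι : Type*} [Finite ι] {G' : ι → Type*}
    [∀ i, Group (G' i)] (f : ∀ i, G' i →* G) (h : ∀ i, PropertyET (G' i))
    (hf : ⨆ i, (f i).range = ⊤) : PropertyET G :=
  IsRigid.propertyET (hf ▸ isRigid_iSup fun i => (h i).isRigid_range (f i))

end ET

end GroupTrace

theorem mainTheorem7 :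
    -- free products of finitely many groups
    (∀ (m : ℕ) (G : Fin m → Type u) [∀ i, Group (G i)],
      (∀ i, GroupTrace.PropertyET (G i)) → GroupTrace.PropertyET (Monoid.CoprodI G)) ∧
    -- quotients
    (∀ (G : Type u) [Group G] (N : Subgroup G) [N.Normal],
      GroupTrace.PropertyET G → GroupTrace.PropertyET (G ⧸ N)) ∧
    -- amalgamated products
    (∀ (H : Type v) (G₁ : Type u) (G₂ : Type w) [Group H] [Group G₁] [Group G₂]
      (f₁ : H →* G₁) (f₂ : H →* G₂),
      GroupTrace.PropertyET G₁ → GroupTrace.PropertyET G₂ →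
        GroupTrace.PropertyET (GroupTrace.AmalgamatedProduct f₁ f₂)) := by
  refine ⟨fun m G _ h => ?_, fun G _ N _ h => ?_, fun H G₁ G₂ _ _ _ f₁ f₂ h₁ h₂ => ?_⟩
  · refine GroupTrace.propertyET_of_iSup_range_eq_top (fun i => Monoid.CoprodI.of) h ?_
    rw [← Monoid.CoprodI.range_eq_iSup, Monoid.CoprodI.lift_of']
    exact MonoidHom.range_eq_top.2 Function.surjective_id
  · refine GroupTrace.IsRigid.propertyET ?_
    rw [← MonoidHom.range_eq_top.2 (QuotientGroup.mk'_surjective N)]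
    exact h.isRigid_range _
  · let q := QuotientGroup.mk' (Subgroup.normalClosure (Set.range fun h : H =>
      (Monoid.Coprod.inl (f₁ h) * (Monoid.Coprod.inr (f₂ h))⁻¹ : Monoid.Coprod G₁ G₂)))
    have hq : (q.comp Monoid.Coprod.inl).range ⊔ (q.comp Monoid.Coprod.inr).range = ⊤ := by
      rw [MonoidHom.range_comp, MonoidHom.range_comp, ← Subgroup.map_sup,
        Monoid.Coprod.range_inl_sup_range_inr, ← MonoidHom.range_eq_map]
      exact MonoidHom.range_eq_top.2 (QuotientGroup.mk'_surjective _)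
    have h := (h₁.isRigid_range (q.comp Monoid.Coprod.inl)).sup
      (h₂.isRigid_range (q.comp Monoid.Coprod.inr))
    rw [hq] at h
    exact h.propertyET
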